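/- Surrounding Cops and Robbers is the following game on a graph $G$. First each cop is placed on a vertex (several cops may share a vertex), then the robber is placed on a vertex not occupied by a cop. The cops and the robber then alternately take turns, the cops first. On the cops' turn each cop stays where she is or moves to an adjacent vertex; on his turn the robber stays or moves to an adjacent vertex. All positions are known to both sides. The cops win if at some time the robber is surrounded, that is, every neighbour of his vertex is occupied by a cop, or if the robber ends one of his turns on a vertex occupied by a cop; the robber wins if this never happens. The surrounding number $\sigma(G)$ is the least number of cops that have a strategy that wins on $G$ no matter how the robber plays. Let $P_n$ be the path on $n$ vertices. The strong product $\boxtimes_{i=1}^k P_{n_i}$ is the graph whose vertices are the $k$-tuples $(v_1,\dots,v_k)$ with $v_i\in V(P_{n_i})$, where two distinct tuples are adjacent if and only if in each coordinate their entries are equal or adjacent. **Theorem.** If $k\ge 1$ and $n_1,\dots,n_k$ are integers with $n_i\ge 3$ for all $1\le i\le k$, then $$\sigma\Bigl(\boxtimes_{i=1}^k P_{n_i}\Bigr)\le\frac{3^k+1}{2}.$$ -/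

import Mathlib

namespace SimpleGraph

/-- The strong product of a family of graphs: two distinct tuples are adjacent when in every
coordinate their entries are equal or adjacent. -/
def strongPi {ι : Type*} {V : ι → Type*} (G : ∀ i, SimpleGraph (V i)) :
    SimpleGraph (∀ i, V i) where
  Adj u v := u ≠ v ∧ ∀ i, u i = v i ∨ (G i).Adj (u i) (v i)
  symm := ⟨fun _ _ h => ⟨h.1.symm, fun i => (h.2 i).imp Eq.symm (fun a => a.symm)⟩⟩
  loopless := ⟨fun _ h => h.1 rfl⟩

variable {V : Type*}

/-- A legal move of one cop, or of the robber: stay, or move along an edge. -/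
def IsStep (G : SimpleGraph V) (u v : V) : Prop := u = v ∨ G.Adj u v

/-- A strategy for `m` cops (several cops may share a vertex). The list is the sequence of
positions of the robber so far, latest first: `pos []` is the initial placement of the cops, and
`pos (v :: h)` is where the cops go on their turn when the robber is at `v` and his earlier
positions are `h`. -/
structure CopStrategy (G : SimpleGraph V) (m : ℕ) where
  pos : List V → Fin m → V
  legal : ∀ (h : List V) (v : V) (i : Fin m), G.IsStep (pos h i) (pos (v :: h) i)

/-- The list of the robber's positions `r (t - 1), …, r 0`. -/
def robberHistory (r : ℕ → V) : ℕ → List V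
  | 0 => []
  | t + 1 => r t :: robberHistory r t

/-- The positions of the cops after their `t`-th turn (`t = 0`: their initial placement) when the
robber plays `r`. -/
def CopStrategy.copsAt {G : SimpleGraph V} {m : ℕ} (S : G.CopStrategy m) (r : ℕ → V) (t : ℕ) :
    Fin m → V :=
  S.pos (robberHistory r t)

/-- The play `r` of the robber is legal against `S`: having seen the placement of the cops, he
starts at a vertex without a cop, and on each turn he stays or moves along an edge. Here `r 0` is
his initial position and `r t` is his position after his `t`-th turn; in each round the cops
move first. -/
def CopStrategy.IsRobberPlay {G : SimpleGraph V} {m : ℕ} (S : G.CopStrategy m) (r : ℕ → V) :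
    Prop :=
  r 0 ∉ Set.range (S.copsAt r 0) ∧ ∀ t, G.IsStep (r t) (r (t + 1))

/-- Cops at the positions `c` surround the vertex `v`: each neighbour of `v` is occupied. -/
def Surrounds (G : SimpleGraph V) {m : ℕ} (c : Fin m → V) (v : V) : Prop :=
  ∀ w, G.Adj v w → w ∈ Set.range c

/-- The cops win Surrounding Cops and Robbers against the play `r`: at some time the robber is
surrounded (after his own placement or turn, or after a turn of the cops), or he ends a turn
on a vertex occupied by a cop. -/
def CopStrategy.WinsAgainst {G : SimpleGraph V} {m : ℕ} (S : G.CopStrategy m) (r : ℕ → V) :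
    Prop :=
  ∃ t, G.Surrounds (S.copsAt r t) (r t) ∨ G.Surrounds (S.copsAt r (t + 1)) (r t) ∨
    r (t + 1) ∈ Set.range (S.copsAt r (t + 1))

/-- `m` cops can win Surrounding Cops and Robbers on `G`. -/
def SurroundingCopsWin (G : SimpleGraph V) (m : ℕ) : Prop :=
  ∃ S : G.CopStrategy m, ∀ r, S.IsRobberPlay r → S.WinsAgainst r

/-- The surrounding number `σ(G)`: the least number of cops that can win Surrounding Cops and
Robbers on `G` (`⊤` if no finite number of cops can). -/
noncomputable def surroundingNumber (G : SimpleGraph V) : ℕ∞ :=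
  ⨅ m ∈ {m : ℕ | G.SurroundingCopsWin m}, (m : ℕ∞)

end SimpleGraph

namespace SimpleGraph

/-! Assign one cop to each lexicographically nonnegative `d` in `{-1, 0, 1} ^ k`, aiming at the
robber's position plus `d`, clamped to the box. After finitely many turns every cop is on target
after each cop turn (`val_copsAt_chaseStrategy`). A robber move by a nonnegative `d`, including
staying, then ends on a cop, so he must descend lexicographically forever, impossible in a finite
graph. Capture alone suffices; surrounding is never needed. -/

/-- The vertex of the path on `n` vertices nearest to the integer `a`. -/
def pathClamp {n : ℕ} (hn : 0 < n) (a : ℤ) : Fin n := ⟨min (n - 1) a.toNat, by omega⟩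

theorem val_pathClamp {n : ℕ} (hn : 0 < n) (a : ℤ) :
    (pathClamp hn a).val = min (n - 1) a.toNat := rfl

/-- The vertex of the path reached from `p` by one step in the direction of `q`. -/
def stepToward {n : ℕ} (p q : Fin n) : Fin n :=
  ⟨if p < q then p + 1 else if q < p then p - 1 else p, by
    split_ifs with h₁ h₂ <;> simp only [Fin.lt_def] at * <;> omega⟩

theorem val_stepToward {n : ℕ} (p q : Fin n) :
    (stepToward p q).val =
      if p.val < q.val then p.val + 1 else if q.val < p.val then p.val - 1 else p.val := rfl

theorem eq_or_adj_stepToward {n : ℕ} (p q : Fin n) :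
    p = stepToward p q ∨ (pathGraph n).Adj p (stepToward p q) := by
  rw [pathGraph_adj, Fin.ext_iff, val_stepToward]
  split_ifs <;> omega

theorem isStep_strongPi_iff {ι : Type*} {V : ι → Type*} {G : ∀ i, SimpleGraph (V i)}
    {u v : ∀ i, V i} :
    (strongPi G).IsStep u v ↔ ∀ i, u i = v i ∨ (G i).Adj (u i) (v i) := by
  constructor
  · rintro (rfl | h) i
    · exact Or.inl rfl
    · exact h.2 i
  · intro h
    by_cases huv : u = v
    · exact Or.inl huv
    · exact Or.inr ⟨huv, h⟩

section Chase

variable {k m : ℕ} {n : Fin k → ℕ} (hn : ∀ i, 0 < n i) (s : Fin m → Fin k → ℤ)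

/-- The positions of cops that start at the origin, where the `i`-th cop always moves towards
the robber's position translated by `s i`. -/
def chasePos : List (∀ j, Fin (n j)) → Fin m → ∀ j, Fin (n j)
  | [] => fun _ j => ⟨0, hn j⟩
  | v :: h => fun i j => stepToward (chasePos h i j) (pathClamp (hn j) ((v j : ℕ) + s i j))

/-- The strategy in which the `i`-th cop chases the robber's position translated by `s i`. -/
def chaseStrategy : (strongPi fun j => pathGraph (n j)).CopStrategy m where
  pos := chasePos hn s
  legal _ _ _ := isStep_strongPi_iff.2 fun _ => eq_or_adj_stepToward _ _

/-- Clamping is 1-Lipschitz, so a target coordinate moves by at most one per round. A cop starting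
at `0` climbs one unit per turn until she meets it, and never loses it afterwards. -/
theorem val_copsAt_chaseStrategy {r : ℕ → ∀ j, Fin (n j)}
    (hr : ∀ t, (strongPi fun j => pathGraph (n j)).IsStep (r t) (r (t + 1))) (t : ℕ)
    (i : Fin m) (j : Fin k) :
    ((chaseStrategy hn s).copsAt r (t + 1) i j).val =
      min (t + 1) (pathClamp (hn j) ((r t j : ℕ) + s i j)).val := by
  have hsucc (t : ℕ) : (chaseStrategy hn s).copsAt r (t + 1) i j =
      stepToward ((chaseStrategy hn s).copsAt r t i j)
        (pathClamp (hn j) ((r t j : ℕ) + s i j)) := rfl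
  induction t with
  | zero =>
    have h0 : ((chaseStrategy hn s).copsAt r 0 i j).val = 0 := rfl
    rw [hsucc, val_stepToward, h0]
    split_ifs <;> omega
  | succ t ih =>
    have hstep := isStep_strongPi_iff.1 (hr t) j
    rw [pathGraph_adj, Fin.ext_iff] at hstep
    have hclamp := val_pathClamp (hn j) ((r t j : ℕ) + s i j)
    have hclamp' := val_pathClamp (hn j) ((r (t + 1) j : ℕ) + s i j)
    rw [hsucc, val_stepToward, ih]
    generalize (pathClamp (hn j) ((r t j : ℕ) + s i j)).val = p at *
    generalize (pathClamp (hn j) ((r (t + 1) j : ℕ) + s i j)).val = q at *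
    have hpq : p ≤ q + 1 ∧ q ≤ p + 1 := by omega
    clear hclamp hclamp' ih hsucc hstep
    split_ifs <;> omega

theorem mem_range_copsAt_chaseStrategy {r : ℕ → ∀ j, Fin (n j)}
    (hr : ∀ t, (strongPi fun j => pathGraph (n j)).IsStep (r t) (r (t + 1))) {t : ℕ}
    (ht : ∀ j, n j ≤ t) (w : ∀ j, Fin (n j)) (i : Fin m)
    (hi : ∀ j, s i j = (w j : ℕ) - (r t j : ℕ)) :
    w ∈ Set.range ((chaseStrategy hn s).copsAt r (t + 1)) := by
  refine ⟨i, funext fun j => Fin.ext ?_⟩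
  rw [val_copsAt_chaseStrategy hn s hr, val_pathClamp, hi]
  have := ht j
  have := (w j).isLt
  -- As `w` lies in the box, clamping leaves it fixed, and `w j < n j ≤ t` removes the cap `t + 1`.
  omega

/-- If the offsets of the cops include every vector in `{-1, 0, 1} ^ k` that is nonnegative in the
lexicographic order, then the cops win: once they are in place, each move of the robber that avoids
them makes his position lexicographically smaller. -/
theorem chaseStrategy_winsAgainst
    (hs : ∀ d : Fin k → ℤ, (∀ j, d j ∈ Finset.Icc (-1) 1) → 0 ≤ toLex d → ∃ i, s i = d)
    {r : ℕ → ∀ j, Fin (n j)} (hr : (chaseStrategy hn s).IsRobberPlay r) :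
    (chaseStrategy hn s).WinsAgainst r := by
  by_contra hwin
  have havoid (t : ℕ) : r (t + 1) ∉ Set.range ((chaseStrategy hn s).copsAt r (t + 1)) :=
    fun h => hwin ⟨t, Or.inr (Or.inr h)⟩
  obtain ⟨T, hT⟩ : ∃ T, ∀ j, n j ≤ T :=
    ⟨∑ j, n j, fun j => Finset.single_le_sum (fun _ _ => Nat.zero_le _) (Finset.mem_univ j)⟩
  let x : ℕ → Lex (Fin k → ℤ) := fun t => toLex fun j => ((r (T + t) j : ℕ) : ℤ)
  have hx : StrictAnti x := by
    refine strictAnti_nat_of_succ_lt fun t => ?_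
    by_contra hle
    -- The offset needed is the robber's own displacement: that cop already stands where he lands.
    obtain ⟨i, hi⟩ := hs (fun j => ((r (T + t + 1) j : ℕ) : ℤ) - (r (T + t) j : ℕ))
      (fun j => by
        have hstep := isStep_strongPi_iff.1 (hr.2 (T + t)) j
        rw [pathGraph_adj, Fin.ext_iff] at hstep
        rw [Finset.mem_Icc]
        omega)
      (sub_nonneg.2 (not_lt.1 hle))
    exact havoid (T + t) (mem_range_copsAt_chaseStrategy hn s hr.2
      (fun j => (hT j).trans (Nat.le_add_right T t)) _ i (fun j => congrFun hi j))
  refine not_injective_infinite_finite (fun t => r (T + t)) fun a b hab => hx.injective ?_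
  exact congrArg (fun v : ∀ j, Fin (n j) => toLex fun j => ((v j : ℕ) : ℤ)) hab

end Chase

open Classical in
/-- The lexicographically nonnegative vectors in `{-1, 0, 1} ^ k`. -/
noncomputable def lexNonnegOffsets (k : ℕ) : Finset (Fin k → ℤ) :=
  {d ∈ Fintype.piFinset fun _ => Finset.Icc (-1) 1 | 0 ≤ toLex d}

-- The order is total and negation swaps positive and negative vectors, so the `3 ^ k - 1` nonzero
-- ones split evenly; zero adds one.
open Classical in
theorem card_lexNonnegOffsets (k : ℕ) : (lexNonnegOffsets k).card = (3 ^ k + 1) / 2 := by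
  set P : Finset (Fin k → ℤ) := Fintype.piFinset fun _ => Finset.Icc (-1) 1 with hP
  have hcard : P.card = 3 ^ k := by simp [hP, Fintype.card_piFinset]
  have hneg (d : Fin k → ℤ) (hd : d ∈ P) : -d ∈ P := by
    simp only [hP, Fintype.mem_piFinset, Finset.mem_Icc, Pi.neg_apply] at hd ⊢
    exact fun j => by have := hd j; omega
  have hsplit : (lexNonnegOffsets k).card + (P.filter fun d => ¬ 0 ≤ toLex d).card = 3 ^ k := by
    rw [← hcard]
    exact Finset.card_filter_add_card_filter_not _
  have hflip : (P.filter fun d => ¬ 0 ≤ toLex d).card =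
      (P.filter fun d => 0 < toLex d).card := by
    refine Finset.card_nbij' (fun d => -d) (fun d => -d) ?_ ?_ ?_ ?_
    · intro d hd
      simp only [Finset.coe_filter, Set.mem_ofPred_eq, not_le] at hd ⊢
      exact ⟨hneg d hd.1, neg_pos.2 hd.2⟩
    · intro d hd
      simp only [Finset.coe_filter, Set.mem_ofPred_eq, not_le] at hd ⊢
      exact ⟨hneg d hd.1, neg_neg_iff_pos.2 hd.2⟩
    · exact fun d _ => neg_neg d
    · exact fun d _ => neg_neg d
  have hinsert : lexNonnegOffsets k = insert 0 (P.filter fun d => 0 < toLex d) := by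
    ext d
    simp only [lexNonnegOffsets, Finset.mem_filter, Finset.mem_insert, ← hP]
    constructor
    · rintro ⟨hd, h0⟩
      rcases h0.eq_or_lt with h | h
      · exact Or.inl (toLex.injective h.symm)
      · exact Or.inr ⟨hd, h⟩
    · rintro (rfl | ⟨hd, h⟩)
      · exact ⟨by simp [hP], le_rfl⟩
      · exact ⟨hd, h.le⟩
  have hsucc : (lexNonnegOffsets k).card = (P.filter fun d => 0 < toLex d).card + 1 := by
    rw [hinsert, Finset.card_insert_of_notMem]
    exact fun h => lt_irrefl _ (Finset.mem_filter.1 h).2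
  omega

end SimpleGraph

theorem mainTheorem9 (k : ℕ) (hk : 1 ≤ k) (n : Fin k → ℕ) (hn : ∀ i, 3 ≤ n i) :
    (SimpleGraph.strongPi fun i : Fin k => SimpleGraph.pathGraph (n i)).surroundingNumber ≤
      (((3 ^ k + 1) / 2 : ℕ) : ℕ∞) := by
  let e := Finset.equivFinOfCardEq (SimpleGraph.card_lexNonnegOffsets k)
  refine iInf₂_le _ ⟨SimpleGraph.chaseStrategy (fun i => (by have := hn i; omega : 0 < n i))
    (fun i => (e.symm i : Fin k → ℤ)), fun r hr =>
      SimpleGraph.chaseStrategy_winsAgainst _ _ (fun d hd h0 => ?_) hr⟩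
  have hmem : d ∈ SimpleGraph.lexNonnegOffsets k :=
    Finset.mem_filter.2 ⟨Fintype.mem_piFinset.2 hd, h0⟩
  exact ⟨e ⟨d, hmem⟩, by rw [Equiv.symm_apply_apply]⟩
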